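/- For $x\in\mathbb{R}$ let $\|x\|$ denote the distance from $x$ to the nearest integer. A set $E\subseteq\mathbb{R}$ is a \emph{Dirichlet set} if there is a strictly increasing sequence $(n_k)_{k\in\mathbb{N}}$ of natural numbers such that $\|n_kx\|\le 2^{-k}$ for all $x\in E$ and all $k\in\mathbb{N}$. The \emph{hereditary family generated by} a collection $\mathcal{C}$ of sets is the family of all subsets of members of $\mathcal{C}$. A set $A\subseteq\mathbb{R}$ is \emph{permitted for} a hereditary family $\mathcal{F}$ of subsets of $\mathbb{R}$ if $A+B\in\mathcal{F}$ for every $B\in\mathcal{F}$. A set $A\subseteq\mathbb{R}$ is \emph{perfectly meager in the transitive sense} if for every perfect set $P\subseteq\mathbb{R}$ there is an $F_\sigma$-set $F\supseteq A$ such that for every $y\in\mathbb{R}$ the set $(F+y)\cap P$ is meager in the relative topology of $P$. \textbf{Theorem.} Let $\mathcal{F}$ be the hereditary family generated by some collection of proper analytic subgroups of $(\mathbb{R},+)$, and suppose that every Dirichlet set belongs to $\mathcal{F}$. Then every set permitted for $\mathcal{F}$ is perfectly meager in the transitive sense. -/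

import Mathlib

open Set Topology MeasureTheory
open scoped Pointwise

/-- `‖x‖`: the distance of the real `x` to the nearest integer. -/
noncomputable def distNearestInt (x : ℝ) : ℝ := |x - round x|

/-- `distNearestInt x = min {|x - k| : k ∈ ℤ}`. -/
theorem distNearestInt_isLeast (x : ℝ) :
    IsLeast (range fun k : ℤ => |x - k|) (distNearestInt x) := by
  refine ⟨⟨round x, rfl⟩, ?_⟩
  rintro _ ⟨k, rfl⟩
  exact round_le x k

/-- `E ⊆ ℝ` is a Dirichlet set: there is an increasing sequence of natural numbers `n k` with
`‖n k * x‖ ≤ 2 ^ (-k)` for all `x ∈ E` and all `k`. -/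
def IsDirichletSet (E : Set ℝ) : Prop :=
  ∃ n : ℕ → ℕ, StrictMono n ∧ ∀ x ∈ E, ∀ k : ℕ, distNearestInt (n k * x) ≤ (1 / 2) ^ k

/-- A family of sets is hereditary if it contains every subset of each of its members. -/
def IsHereditary {X : Type*} (F : Set (Set X)) : Prop :=
  ∀ B ∈ F, ∀ A, A ⊆ B → A ∈ F

/-- The hereditary family generated by a collection of sets: all subsets of members. -/
def hereditaryFamily {X : Type*} (C : Set (Set X)) : Set (Set X) :=
  {A | ∃ B ∈ C, A ⊆ B}

/-- It is the least hereditary family that includes the collection. -/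
theorem hereditaryFamily_isLeast {X : Type*} (C : Set (Set X)) :
    IsLeast {F | IsHereditary F ∧ C ⊆ F} (hereditaryFamily C) := by
  refine ⟨⟨?_, fun B hB => ⟨B, hB, Subset.rfl⟩⟩, ?_⟩
  · rintro B ⟨D, hD, hBD⟩ A hAB
    exact ⟨D, hD, hAB.trans hBD⟩
  · rintro F ⟨hF, hCF⟩ A ⟨B, hB, hAB⟩
    exact hF B (hCF hB) A hAB

/-- `A` is permitted for the family `F`: `A + B ∈ F` for every `B ∈ F`. -/
def IsPermittedFor {X : Type*} [Add X] (F : Set (Set X)) (A : Set X) : Prop :=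
  ∀ B ∈ F, A + B ∈ F

/-- An `F_σ`-set: a union of countably many closed sets. -/
def IsFSigma {X : Type*} [TopologicalSpace X] (S : Set X) : Prop :=
  ∃ f : ℕ → Set X, (∀ n, IsClosed (f n)) ∧ S = ⋃ n, f n

/-- `S ∩ P` is meager in the relative topology of `P`. -/
def IsMeagerIn {X : Type*} [TopologicalSpace X] (S P : Set X) : Prop :=
  IsMeagre {p : P | (p : X) ∈ S}

/-- `A` is perfectly meager in the transitive sense: for every perfect set `P` there is an
`F_σ`-set `F ⊇ A` such that for every `y`, `(F + y) ∩ P` is meager in `P`. -/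
def IsPerfectlyMeagerTransitive {X : Type*} [TopologicalSpace X] [AddGroup X]
    (A : Set X) : Prop :=
  ∀ P : Set X, Perfect P →
    ∃ F : Set X, IsFSigma F ∧ A ⊆ F ∧ ∀ y : X, IsMeagerIn (F + {y}) P

/-! Fix a perfect set `P`. The proof builds a Dirichlet set `M` adapted to `P`: near `p₀ + m₀`, with
`p₀` in `P` and `m₀` in a dense subset of `M`, the sums of points of `P` near `p₀` and points of `M`
near `m₀` are dense in a ball (`IsSpreadingSequence.exists_ball_subset_closure`).

If `A` is permitted, `A + M` lies in a proper analytic subgroup. Such a subgroup is meagre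
(`AddSubgroup.isMeagre_of_analyticSet`), so it is covered by closed sets `K i` with empty interior.
For `x ∈ A`, the Baire category theorem in `M` yields a basic open `V` meeting `M` with `x + (M ∩ V)
⊆ K i` (`exists_mem_translateInto`). For each pair `(i, V)` the set of all such `x` is closed, and
these countably many sets form the required `F_σ`-set. If a translate of one of them contained a
nonempty relatively open piece of `P`, density of the sums would put a ball inside a translate of `K
i`, which is impossible (`isMeagerIn_translateInto_add`).

The frequencies defining `M` exist because `P` has no isolated points: for distinct `p, q ∈ P`, `ν *
(p - q)` runs through all residues modulo `1` as `ν` runs through a long enough interval. -/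

/-! ### Baire category of analytic sets. -/

/-- The image under `f` of the basic open set of sequences with (reversed) initial segment `s`. -/
def cylinderImage {X : Type*} (f : (ℕ → ℕ) → X) (s : List ℕ) : Set X :=
  f '' {x | PiNat.res x s.length = s}

theorem cylinderImage_nil {X : Type*} (f : (ℕ → ℕ) → X) : cylinderImage f [] = range f := by
  simp [cylinderImage]

theorem cylinderImage_subset_iUnion {X : Type*} (f : (ℕ → ℕ) → X) (s : List ℕ) :
    cylinderImage f s ⊆ ⋃ n, cylinderImage f (n :: s) := by
  rintro _ ⟨x, hx, rfl⟩
  refine mem_iUnion.2 ⟨x s.length, x, ?_, rfl⟩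
  have hx' : PiNat.res x s.length = s := hx
  simp [PiNat.res_succ, hx']

/-- The largest open set in which `S` is meagre (in a second countable space). -/
def meagrePart {X : Type*} [TopologicalSpace X] (S : Set X) : Set X :=
  ⋃₀ {U | IsOpen U ∧ IsMeagre (S ∩ U)}

theorem isOpen_meagrePart {X : Type*} [TopologicalSpace X] (S : Set X) :
    IsOpen (meagrePart S) :=
  isOpen_sUnion fun _ h => h.1

theorem subset_meagrePart {X : Type*} [TopologicalSpace X] {S U : Set X} (hU : IsOpen U)
    (h : IsMeagre (S ∩ U)) : U ⊆ meagrePart S :=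
  subset_sUnion_of_mem ⟨hU, h⟩

theorem isMeagre_inter_meagrePart {X : Type*} [TopologicalSpace X] [SecondCountableTopology X]
    (S : Set X) : IsMeagre (S ∩ meagrePart S) := by
  obtain ⟨T, hTc, hTs, hTU⟩ := TopologicalSpace.isOpen_sUnion_countable
    {U | IsOpen U ∧ IsMeagre (S ∩ U)} (fun _ h => h.1)
  have : Countable T := hTc.to_subtype
  rw [meagrePart, ← hTU, sUnion_eq_iUnion, inter_iUnion]
  exact isMeagre_iUnion fun U => (hTs U.2).2

theorem isNowhereDense_closure_diff {X : Type*} [TopologicalSpace X] {O : Set X}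
    (hO : IsOpen O) : IsNowhereDense (closure O \ O) := by
  have h : closure O \ O = frontier Oᶜ := by rw [frontier_compl, frontier, hO.interior_eq]
  rw [h, IsNowhereDense, isClosed_frontier.closure_eq]
  exact interior_frontier hO.isClosed_compl

theorem isMeagre_of_dense_meagrePart {X : Type*} [TopologicalSpace X]
    [SecondCountableTopology X] {S U : Set X} (hU : U ⊆ closure (meagrePart S)) :
    IsMeagre (S ∩ U) := by
  refine ((isMeagre_inter_meagrePart S).union
    (isNowhereDense_closure_diff (isOpen_meagrePart S)).isMeagre).mono ?_
  rintro x ⟨hxS, hxU⟩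
  by_cases h : x ∈ meagrePart S
  · exact Or.inl ⟨hxS, h⟩
  · exact Or.inr ⟨hU hxU, h⟩

/-- The interior of the complement of `meagrePart S`: the open set in which `S` is everywhere
non-meagre. -/
def nonmeagrePart {X : Type*} [TopologicalSpace X] (S : Set X) : Set X :=
  interior (meagrePart S)ᶜ

theorem nonmeagrePart_eq {X : Type*} [TopologicalSpace X] (S : Set X) :
    nonmeagrePart S = (closure (meagrePart S))ᶜ := interior_compl

theorem nonmeagrePart_subset_closure {X : Type*} [TopologicalSpace X] (S : Set X) :
    nonmeagrePart S ⊆ closure S := by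
  intro x hx
  by_contra h
  refine interior_subset hx (subset_meagrePart isClosed_closure.isOpen_compl ?_ h)
  have : S ∩ (closure S)ᶜ = ∅ := by
    rw [← sdiff_eq, sdiff_eq_empty]
    exact subset_closure
  rw [this]
  exact IsMeagre.empty

/-- Off the closure of the union on the right every `T n` is meagre, hence so is `S`; but `S` is
meagre in no nonempty open subset of `nonmeagrePart S`. -/
theorem nonmeagrePart_subset_closure_iUnion {X : Type*} [TopologicalSpace X]
    [SecondCountableTopology X] {S : Set X} {T : ℕ → Set X} (h : S ⊆ ⋃ n, T n) :
    nonmeagrePart S ⊆ closure (⋃ n, nonmeagrePart (T n)) := by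
  intro x hx
  by_contra hxO
  have hopen : IsOpen (nonmeagrePart S ∩ (closure (⋃ n, nonmeagrePart (T n)))ᶜ) :=
    isOpen_interior.inter isClosed_closure.isOpen_compl
  refine interior_subset hx (subset_meagrePart hopen ?_ ⟨hx, hxO⟩)
  have hn : ∀ n, IsMeagre (T n ∩ (closure (⋃ n, nonmeagrePart (T n)))ᶜ) := by
    intro n
    refine isMeagre_of_dense_meagrePart fun y hy => ?_
    by_contra hy'
    rw [← mem_compl_iff, ← nonmeagrePart_eq] at hy'
    exact hy (subset_closure (mem_iUnion.2 ⟨n, hy'⟩))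
  refine (isMeagre_iUnion hn).mono ?_
  rintro y ⟨hyS, -, hy⟩
  obtain ⟨n, hn⟩ := mem_iUnion.1 (h hyS)
  exact mem_iUnion.2 ⟨n, hn, hy⟩

/-- A continuous image of the Baire space is comeagre in the open set in which it is everywhere
non-meagre. -/
theorem isMeagre_nonmeagrePart_diff_range {X : Type*} [TopologicalSpace X] [T2Space X]
    [SecondCountableTopology X] {f : (ℕ → ℕ) → X} (hf : Continuous f) :
    IsMeagre (nonmeagrePart (range f) \ range f) := by
  let V : List ℕ → Set X := fun s => nonmeagrePart (cylinderImage f s)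
  have hE : IsMeagre (⋃ s, V s \ ⋃ n, V (n :: s)) := by
    refine isMeagre_iUnion fun s => ?_
    refine (isNowhereDense_closure_diff
      (isOpen_iUnion fun n => isOpen_interior (s := (meagrePart (cylinderImage f (n :: s)))ᶜ))
      ).isMeagre.mono ?_
    exact sdiff_subset_sdiff_left
      (nonmeagrePart_subset_closure_iUnion (cylinderImage_subset_iUnion f s))
  refine hE.mono ?_
  rintro x ⟨hxV, hxf⟩
  by_contra hx
  -- Outside the meagre set of `hE`, membership in `V s` passes to a child of `s`. The resulting
  -- branch `σ` has `x` in the closure of the image of each of its cylinders, so continuity forces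
  -- `x = f σ`.
  have step : ∀ s, x ∈ V s → ∃ n, x ∈ V (n :: s) := by
    intro s hs
    by_contra hn
    exact hx (mem_iUnion.2 ⟨s, hs, fun h => hn (mem_iUnion.1 h)⟩)
  choose! g hg using step
  let s : ℕ → List ℕ := fun k => Nat.rec [] (fun _ s => g s :: s) k
  have hs : ∀ k, x ∈ V (s k) := by
    intro k
    induction k with
    | zero =>
      change x ∈ nonmeagrePart (cylinderImage f [])
      rwa [cylinderImage_nil]
    | succ k ih => exact hg _ ih
  let σ : ℕ → ℕ := fun k => g (s k)
  have hσ : ∀ k, PiNat.res σ k = s k := by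
    intro k
    induction k with
    | zero => rfl
    | succ k ih => rw [PiNat.res_succ, ih]
  have hne : x ≠ f σ := fun h => hxf ⟨σ, h.symm⟩
  obtain ⟨U, U', hU, hU', hxU, hfU', hd⟩ := t2_separation hne
  obtain ⟨_, ⟨y, k, rfl⟩, hyσ, hyU⟩ := (PiNat.isTopologicalBasis_cylinders
    (fun _ : ℕ => ℕ)).exists_subset_of_mem_open (show σ ∈ f ⁻¹' U' from hfU')
      (hU'.preimage hf)
  obtain ⟨z, hzU, τ, hτ, rfl⟩ :=
    mem_closure_iff.1 (nonmeagrePart_subset_closure _ (hs k)) U hU hxU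
  refine disjoint_left.1 hd hzU (hyU ?_)
  have hτ' : PiNat.res τ (s k).length = s k := hτ
  rw [← hσ k, PiNat.res_length, PiNat.res_eq_res] at hτ'
  rw [PiNat.mem_cylinder_iff] at hyσ ⊢
  intro i hi
  rw [hτ' hi, hyσ i hi]

theorem exists_isOpen_isMeagre_diff_of_analyticSet {X : Type*} [TopologicalSpace X] [T2Space X]
    [SecondCountableTopology X] {S : Set X} (hS : AnalyticSet S) (h : ¬ IsMeagre S) :
    ∃ V : Set X, IsOpen V ∧ V.Nonempty ∧ IsMeagre (V \ S) := by
  rw [AnalyticSet] at hS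
  obtain rfl | ⟨f, hf, rfl⟩ := hS
  · exact absurd IsMeagre.empty h
  refine ⟨_, isOpen_interior, ?_, isMeagre_nonmeagrePart_diff_range hf⟩
  by_contra hne
  rw [not_nonempty_iff_eq_empty] at hne
  refine h ?_
  have := isMeagre_of_dense_meagrePart (S := range f) (U := univ) (by
    rw [univ_subset_iff, ← compl_empty_iff, ← nonmeagrePart_eq]
    exact hne)
  rwa [inter_univ] at this

/-! ### Proper analytic subgroups are meagre. -/

/-- A subgroup of `ℝ` which is comeagre in a nonempty open set is the whole of `ℝ`. -/
theorem AddSubgroup.eq_top_of_isMeagre_diff {G : AddSubgroup ℝ} {V : Set ℝ} (hV : IsOpen V)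
    (hne : V.Nonempty) (h : IsMeagre (V \ (G : Set ℝ))) : G = ⊤ := by
  obtain ⟨x, hx⟩ := hne
  obtain ⟨ε, hε, hεV⟩ := Metric.isOpen_iff.1 hV x hx
  have hsmall : ∀ t : ℝ, |t| < ε → t ∈ G := by
    intro t ht
    by_contra htG
    let e : ℝ ≃ₜ ℝ := Homeomorph.addRight (-t)
    have hm := h.preimage_of_isOpenMap e.continuous e.isOpenMap
    -- If `t ∉ G`, then `y` and `y - t` are never both in `G`, so `V ∩ (V + t)` is covered by two
    -- meagre sets.
    refine not_isMeagre_of_isOpen (hV.inter (hV.preimage e.continuous)) ⟨x, hx, hεV ?_⟩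
      ((h.union hm).mono ?_)
    · simpa [e, Real.dist_eq] using ht
    · rintro y ⟨hy, hy'⟩
      by_cases hyG : y ∈ G
      · refine Or.inr ⟨hy', fun hyt => htG ?_⟩
        have : y + -t ∈ G := hyt
        have := G.sub_mem hyG this
        simpa using this
      · exact Or.inl ⟨hy, hyG⟩
  refine (AddSubgroup.eq_top_iff' G).2 fun y => ?_
  obtain ⟨n, hn⟩ := exists_nat_gt (|y| / ε)
  have hn0 : (0 : ℝ) < n := (div_nonneg (abs_nonneg y) hε.le).trans_lt hn
  have : y / n ∈ G := by
    refine hsmall _ ?_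
    rw [abs_div, abs_of_pos hn0, div_lt_iff₀ hn0]
    rw [div_lt_iff₀ hε] at hn
    linarith
  have := G.nsmul_mem this n
  rwa [nsmul_eq_mul, mul_div_cancel₀ _ hn0.ne'] at this

theorem AddSubgroup.isMeagre_of_analyticSet {G : AddSubgroup ℝ} (hG : AnalyticSet (G : Set ℝ))
    (hne : G ≠ ⊤) : IsMeagre (G : Set ℝ) := by
  by_contra h
  obtain ⟨V, hV, hVne, hVG⟩ := exists_isOpen_isMeagre_diff_of_analyticSet hG h
  exact hne (AddSubgroup.eq_top_of_isMeagre_diff hV hVne hVG)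

theorem IsMeagre.exists_subset_iUnion_isClosed {X : Type*} [TopologicalSpace X] {S : Set X}
    (h : IsMeagre S) : ∃ K : ℕ → Set X,
      (∀ n, IsClosed (K n) ∧ interior (K n) = ∅) ∧ S ⊆ ⋃ n, K n := by
  obtain ⟨T, hT, hTc, hST⟩ := isMeagre_iff_countable_union_isNowhereDense.1 h
  -- Adding `∅` makes the family nonempty, so that it can be enumerated by `ℕ`.
  obtain ⟨f, hf⟩ := (hTc.insert ∅).exists_eq_range ⟨∅, mem_insert _ _⟩
  refine ⟨fun n => closure (f n), fun n => ⟨isClosed_closure, ?_⟩, ?_⟩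
  · have : f n ∈ insert ∅ T := hf ▸ mem_range_self n
    obtain h0 | h0 := this
    · simp [h0]
    · exact hT _ h0
  · refine hST.trans (sUnion_subset fun t ht => ?_)
    obtain ⟨n, rfl⟩ : t ∈ range f := hf ▸ mem_insert_of_mem _ ht
    exact subset_closure.trans (subset_iUnion (fun n => closure (f n)) n)

/-! ### Approximation modulo 1 along a perfect set. -/

theorem distNearestInt_le (x : ℝ) (j : ℤ) : distNearestInt x ≤ |x - j| := round_le x j

theorem distNearestInt_intCast (j : ℤ) : distNearestInt j = 0 := by simp [distNearestInt]

theorem distNearestInt_le_add (x y : ℝ) :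
    distNearestInt x ≤ distNearestInt y + |x - y| := by
  refine (distNearestInt_le x (round y)).trans ?_
  rw [distNearestInt, add_comm, ← sub_add_sub_cancel x y]
  exact abs_add_le _ _

theorem continuous_distNearestInt : Continuous distNearestInt := by
  refine (LipschitzWith.of_le_add fun x y => ?_).continuous
  exact distNearestInt_le_add x y

theorem exists_mul_eq_add_int {d : ℝ} (hd : d ≠ 0) (t a : ℝ) :
    ∃ b : ℝ, ∃ j : ℤ, a ≤ b ∧ b ≤ a + 1 / |d| ∧ b * d = t + j := by
  rcases lt_or_gt_of_ne hd with h | h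
  · refine ⟨(t + ⌊a * d - t⌋) / d, ⌊a * d - t⌋, ?_, ?_, div_mul_cancel₀ _ hd⟩
    · rw [le_div_iff_of_neg h]
      linarith [Int.floor_le (a * d - t)]
    · rw [abs_of_neg h, div_le_iff_of_neg h, add_mul, one_div, inv_neg, neg_mul,
        inv_mul_cancel₀ hd]
      linarith [Int.lt_floor_add_one (a * d - t)]
  · refine ⟨(t + ⌈a * d - t⌉) / d, ⌈a * d - t⌉, ?_, ?_, div_mul_cancel₀ _ hd⟩
    · rw [le_div_iff₀ h]
      linarith [Int.le_ceil (a * d - t)]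
    · rw [abs_of_pos h, div_le_iff₀ h, add_mul, one_div, inv_mul_cancel₀ hd]
      linarith [Int.ceil_lt_add_one (a * d - t)]

/-- Simultaneous approximation: given finitely many pairs `(q, t)` with `q` in a set `P` without
isolated points, every sufficiently long interval has a subinterval of length `D` for each point
`ν` of which `ν * (p - q)` is close to `t` modulo `1` for some `p ∈ P` near `q`. -/
theorem Preperfect.exists_interval_approx {P : Set ℝ} (hP : Preperfect P) {ρ ε : ℝ} (hρ : 0 < ρ)
    (hε : 0 < ε) (L : List (ℝ × ℝ)) (hL : ∀ x ∈ L, x.1 ∈ P) (D : ℝ) (hD : 0 < D) :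
    ∃ Λ : ℝ, ∀ a : ℝ, ∃ b : ℝ, a ≤ b ∧ b + D ≤ a + Λ ∧ ∀ ν, b ≤ ν → ν ≤ b + D →
      ∀ x ∈ L, ∃ p ∈ P, |p - x.1| ≤ ρ ∧ ∃ j : ℤ, |ν * (p - x.1) - x.2 - j| ≤ ε := by
  induction L generalizing D with
  | nil => exact ⟨D, fun a => ⟨a, le_rfl, le_rfl, by simp⟩⟩
  | cons x L ih =>
    obtain ⟨q, t⟩ := x
    have hq : q ∈ P := hL (q, t) (by simp)
    -- With `|p - q| < ε / D`, the product `ν * (p - q)` varies by less than `ε` over an interval of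
    -- length `D`. The tail of the list is given the extra length `1 / |p - q|`, enough to hit `t`
    -- modulo `1` inside its interval.
    obtain ⟨p, ⟨hpb, hpP⟩, hpq⟩ := preperfect_iff_nhds.1 hP q hq _
      (Metric.ball_mem_nhds q (lt_min hρ (div_pos hε hD)))
    rw [Metric.mem_ball, Real.dist_eq, lt_min_iff, lt_div_iff₀ hD] at hpb
    have hd : p - q ≠ 0 := sub_ne_zero.2 hpq
    obtain ⟨Λ, hΛ⟩ := ih (fun x hx => hL x (List.mem_cons_of_mem _ hx)) (1 / |p - q| + D)
      (by positivity)
    refine ⟨Λ, fun a => ?_⟩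
    obtain ⟨b₁, hab₁, hb₁, H⟩ := hΛ a
    obtain ⟨b, j, hb, hb', hbj⟩ := exists_mul_eq_add_int hd t b₁
    refine ⟨b, hab₁.trans hb, by linarith, fun ν hν hν' x hx => ?_⟩
    rcases List.mem_cons.1 hx with rfl | hx
    · refine ⟨p, hpP, hpb.1.le, j, ?_⟩
      have : ν * (p - q) - t - j = (p - q) * (ν - b) := by linarith
      rw [this, abs_mul, abs_of_nonneg (sub_nonneg.2 hν)]
      have : |p - q| * (ν - b) ≤ |p - q| * D :=
        mul_le_mul_of_nonneg_left (by linarith) (abs_nonneg _)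
      linarith
    · exact H ν (hb.trans hν) (by linarith) x hx

/-- One `n` serves all `p₀` and `z`: compactness leaves finitely many centres `q`, and the residue
of `n * (z - q)` is rounded down to one of the `m` values `i / m`. An interval of length `N` of good
frequencies contains a multiple of `N`. -/
theorem Perfect.exists_multiple_approx {P : Set ℝ} (hP : Perfect P) (R : ℝ) {ρ ε : ℝ}
    (hρ : 0 < ρ) (hε : 0 < ε) {N : ℕ} (hN : 0 < N) :
    ∃ n : ℕ, N ∣ n ∧ 2 * N ≤ n ∧ ∀ p₀ ∈ P, |p₀| ≤ R → ∀ z : ℝ,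
      ∃ p ∈ P, |p - p₀| ≤ ρ ∧ distNearestInt (n * (z - p)) ≤ ε := by
  have hcomp : IsCompact (P ∩ Icc (-R) R) := isCompact_Icc.inter_left hP.closed
  obtain ⟨T, hTs, hTf, hT⟩ := hcomp.finite_cover_balls (half_pos hρ)
  obtain ⟨m, hm⟩ := exists_nat_gt (2 / ε)
  have hm0 : (0 : ℝ) < m := (by positivity : (0 : ℝ) < 2 / ε).trans hm
  have hmε : 1 / (m : ℝ) ≤ ε / 2 := by
    rw [div_lt_iff₀ hε] at hm
    rw [div_le_div_iff₀ hm0 two_pos]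
    linarith
  have hN' : (0 : ℝ) < N := by exact_mod_cast hN
  obtain ⟨Λ, hΛ⟩ := hP.acc.exists_interval_approx (half_pos hρ) (half_pos hε)
    (hTf.toFinset ×ˢ (Finset.range m).image fun i : ℕ => (i : ℝ) / m).toList (by
      rintro ⟨q, t⟩ hx
      simp only [Finset.mem_toList, Finset.mem_product, Finite.mem_toFinset] at hx
      exact (hTs hx.1).1) N hN'
  obtain ⟨b, hb, -, H⟩ := hΛ (2 * N)
  have hb0 : 0 ≤ b := by linarith
  have hn1 : b ≤ (N * ⌈b / N⌉₊ : ℕ) := by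
    push_cast
    rw [← div_le_iff₀' hN']
    exact Nat.le_ceil _
  have hn2 : ((N * ⌈b / N⌉₊ : ℕ) : ℝ) ≤ b + N := by
    have := (Nat.ceil_lt_add_one (div_nonneg hb0 hN'.le)).le
    push_cast
    calc (N : ℝ) * ⌈b / N⌉₊ ≤ N * (b / N + 1) := mul_le_mul_of_nonneg_left this hN'.le
      _ = b + N := by field_simp
  refine ⟨N * ⌈b / N⌉₊, dvd_mul_right _ _, by exact_mod_cast hb.trans hn1, ?_⟩
  generalize N * ⌈b / N⌉₊ = n at hn1 hn2
  intro p₀ hp₀ hR z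
  obtain ⟨q, hqT, hq⟩ := mem_iUnion₂.1 (hT ⟨hp₀, abs_le.1 hR⟩)
  rw [Metric.mem_ball, Real.dist_eq] at hq
  have hy0 := Int.fract_nonneg (n * (z - q))
  have hy1 := Int.fract_lt_one (n * (z - q))
  have hym : 0 ≤ Int.fract (n * (z - q)) * m := mul_nonneg hy0 hm0.le
  obtain ⟨p, hpP, hpq, j, hj⟩ := H n hn1 hn2
    (q, (⌊Int.fract (n * (z - q)) * m⌋₊ : ℝ) / m) (by
      simp only [Finset.mem_toList, Finset.mem_product, Finite.mem_toFinset]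
      refine ⟨hqT, Finset.mem_image_of_mem _ (Finset.mem_range.2 ?_)⟩
      rw [Nat.floor_lt hym]
      nlinarith)
  refine ⟨p, hpP, ?_, ?_⟩
  · rw [abs_sub_comm] at hq
    have := abs_sub_le p q p₀
    linarith
  · refine (distNearestInt_le _ (⌊n * (z - q)⌋ - j)).trans ?_
    have h1 : |Int.fract (n * (z - q)) - (⌊Int.fract (n * (z - q)) * m⌋₊ : ℝ) / m| ≤ 1 / m := by
      have hf := Nat.floor_le hym
      have hf' := Nat.lt_floor_add_one (Int.fract (n * (z - q)) * m)
      rw [← div_le_iff₀ hm0] at hf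
      rw [← lt_div_iff₀ hm0, add_div] at hf'
      rw [abs_of_nonneg] <;> linarith
    have h2 : n * (z - p) - ((⌊n * (z - q)⌋ - j : ℤ) : ℝ) =
        (Int.fract (n * (z - q)) - (⌊Int.fract (n * (z - q)) * m⌋₊ : ℝ) / m) -
        (n * (p - q) - (⌊Int.fract (n * (z - q)) * m⌋₊ : ℝ) / m - j) := by
      have := Int.self_sub_floor (n * (z - q))
      push_cast
      linarith
    rw [h2]
    refine (abs_sub _ _).trans ?_
    simp only at hj
    linarith

/-! ### Spreading sequences of frequencies. -/

/-- A sequence of natural numbers, each a proper divisor of the next, whose multiples of `P`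
near any given point of `P` are fine modulo `1`. -/
structure IsSpreadingSequence (P : Set ℝ) (n : ℕ → ℕ) : Prop where
  pos : ∀ k, 0 < n k
  dvd : ∀ k, n k ∣ n (k + 1)
  two_mul_le : ∀ k, 2 * n k ≤ n (k + 1)
  approx : ∀ k : ℕ, ∀ p₀ ∈ P, |p₀| ≤ k → ∀ z : ℝ, ∃ p ∈ P,
    |p - p₀| ≤ (1 / 2) ^ k / (8 * n k) ∧
      distNearestInt (n (k + 1) * (z - p)) ≤ (1 / 2) ^ (k + 1) / 4

theorem Perfect.exists_isSpreadingSequence {P : Set ℝ} (hP : Perfect P) :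
    ∃ n, IsSpreadingSequence P n := by
  have step : ∀ (k : ℕ) (N : {N : ℕ // 0 < N}), ∃ n : {N : ℕ // 0 < N},
      N.1 ∣ n.1 ∧ 2 * N.1 ≤ n.1 ∧ ∀ p₀ ∈ P, |p₀| ≤ k → ∀ z : ℝ, ∃ p ∈ P,
        |p - p₀| ≤ (1 / 2) ^ k / (8 * N.1) ∧
          distNearestInt (n.1 * (z - p)) ≤ (1 / 2) ^ (k + 1) / 4 := by
    rintro k ⟨N, hN⟩
    have hN' : (0 : ℝ) < N := by exact_mod_cast hN
    obtain ⟨n, h1, h2, h3⟩ := hP.exists_multiple_approx k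
      (ρ := (1 / 2) ^ k / (8 * N)) (ε := (1 / 2) ^ (k + 1) / 4) (by positivity)
      (by positivity) hN
    exact ⟨⟨n, by omega⟩, h1, h2, h3⟩
  choose g hg using step
  let n : ℕ → {N : ℕ // 0 < N} := fun k => Nat.rec ⟨1, one_pos⟩ g k
  exact ⟨fun k => (n k).1, fun k => (n k).2, fun k => (hg k (n k)).1,
    fun k => (hg k (n k)).2.1, fun k => (hg k (n k)).2.2⟩

namespace IsSpreadingSequence

variable {P : Set ℝ} {n : ℕ → ℕ}

theorem strictMono (hn : IsSpreadingSequence P n) : StrictMono n :=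
  strictMono_nat_of_lt_succ fun k => by
    have := hn.pos k
    have := hn.two_mul_le k
    omega

theorem dvd_of_le (hn : IsSpreadingSequence P n) {i j : ℕ} (h : i ≤ j) : n i ∣ n j := by
  induction j, h using Nat.le_induction with
  | base => exact dvd_rfl
  | succ j _ ih => exact ih.trans (hn.dvd j)

theorem cast_pos (hn : IsSpreadingSequence P n) (k : ℕ) : (0 : ℝ) < n k := by
  exact_mod_cast hn.pos k

theorem one_le_cast (hn : IsSpreadingSequence P n) (k : ℕ) : (1 : ℝ) ≤ n k := by
  exact_mod_cast hn.pos k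

theorem cast_le (hn : IsSpreadingSequence P n) {i j : ℕ} (h : i ≤ j) : (n i : ℝ) ≤ n j := by
  exact_mod_cast hn.strictMono.monotone h

theorem distNearestInt_mul_eq_zero (hn : IsSpreadingSequence P n) {i j : ℕ} (h : i ≤ j) {x : ℝ}
    {a : ℤ} (hx : n i * x = a) : distNearestInt (n j * x) = 0 := by
  obtain ⟨c, hc⟩ := hn.dvd_of_le h
  have : (n j : ℝ) * x = ((c * a : ℤ) : ℝ) := by
    rw [hc]
    push_cast
    rw [← hx]
    ring
  rw [this, distNearestInt_intCast]

/-- The point of `P` is corrected once for each new index. The steps shrink geometrically, and those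
made after index `j` is treated change `n j * (z - p)` by at most `(1 / 2) ^ j / 4`, which doubles
the initial error at worst. -/
theorem exists_approx (hn : IsSpreadingSequence P n) (d k : ℕ) (p₀ : ℝ) (hp₀ : p₀ ∈ P)
    (hk : |p₀| ≤ k) (z : ℝ) : ∃ p ∈ P, |p - p₀| ≤ (1 / 2) ^ k / (4 * n k) ∧
      ∀ j, k < j → j ≤ k + d → distNearestInt (n j * (z - p)) ≤ (1 / 2) ^ j / 2 := by
  induction d generalizing k p₀ with
  | zero =>
    have := hn.cast_pos k
    exact ⟨p₀, hp₀, by rw [sub_self, abs_zero]; positivity, fun j h1 h2 => by omega⟩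
  | succ d ih =>
    have hpos := hn.cast_pos k
    have hpos' := hn.cast_pos (k + 1)
    have h1 := hn.one_le_cast k
    have h2 : (2 : ℝ) * n k ≤ n (k + 1) := by exact_mod_cast hn.two_mul_le k
    have hpow : (0 : ℝ) < (1 / 2) ^ k := by positivity
    have hpow1 : ((1 : ℝ) / 2) ^ k ≤ 1 := pow_le_one₀ (by norm_num) (by norm_num)
    obtain ⟨p₁, hp₁, hp₁₀, hd⟩ := hn.approx k p₀ hp₀ hk z
    have hρ : (1 / 2 : ℝ) ^ k / (8 * n k) ≤ 1 := by
      rw [div_le_one (by positivity)]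
      linarith
    obtain ⟨p, hp, hpp₁, H⟩ := ih (k + 1) p₁ hp₁ (by
      push_cast
      have := abs_sub_abs_le_abs_sub p₁ p₀
      linarith)
    refine ⟨p, hp, ?_, fun j hj hj' => ?_⟩
    · have h3 : (1 / 2 : ℝ) ^ (k + 1) / (4 * n (k + 1)) ≤ (1 / 2 : ℝ) ^ k / (8 * n k) := by
        rw [pow_succ]
        refine div_le_div₀ hpow.le (by linarith) (by positivity) (by linarith)
      have h4 : (1 / 2 : ℝ) ^ k / (8 * n k) + (1 / 2 : ℝ) ^ k / (8 * n k) =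
          (1 / 2 : ℝ) ^ k / (4 * n k) := by
        field_simp
        norm_num
      have := abs_sub_le p p₁ p₀
      linarith
    · rcases (Nat.succ_le_of_lt hj).eq_or_lt with rfl | hj
      · have h5 := distNearestInt_le_add (n (k + 1) * (z - p)) (n (k + 1) * (z - p₁))
        rw [← mul_sub, abs_mul, abs_of_pos hpos', sub_sub_sub_cancel_left, abs_sub_comm] at h5
        have h6 := mul_le_mul_of_nonneg_left hpp₁ hpos'.le
        have h7 : (n (k + 1) : ℝ) * ((1 / 2 : ℝ) ^ (k + 1) / (4 * n (k + 1))) =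
            (1 / 2 : ℝ) ^ (k + 1) / 4 := by
          field_simp
        simp only [Nat.succ_eq_add_one] at *
        linarith
      · exact H j hj (by omega)

end IsSpreadingSequence

/-! ### The Dirichlet set and density of its sums with `P`. -/

/-- The points `x` with `‖n k * x‖ < 2 ^ (-k)` for all `k` one of whose multiples `n k * x` is an
integer. -/
def terminatingPoints (n : ℕ → ℕ) : Set ℝ :=
  {x | (∀ k, distNearestInt (n k * x) < (1 / 2) ^ k) ∧ ∃ k, ∃ a : ℤ, n k * x = a}

theorem zero_mem_terminatingPoints (n : ℕ → ℕ) : (0 : ℝ) ∈ terminatingPoints n := by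
  refine ⟨fun k => ?_, 0, 0, by simp⟩
  have := distNearestInt_intCast 0
  rw [Int.cast_zero] at this
  rw [mul_zero, this]
  positivity

theorem isDirichletSet_closure_terminatingPoints {n : ℕ → ℕ} (hn : StrictMono n) :
    IsDirichletSet (closure (terminatingPoints n)) := by
  refine ⟨n, hn, fun x hx k => ?_⟩
  have hc : IsClosed {x : ℝ | distNearestInt (n k * x) ≤ (1 / 2) ^ k} :=
    isClosed_le (continuous_distNearestInt.comp (continuous_const.mul continuous_id))
      continuous_const
  exact closure_minimal (fun y hy => (hy.1 k).le) hc hx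

/-- Near the sum of a point of `P` and a terminating point, the sums of nearby points of these sets
are dense. -/
theorem IsSpreadingSequence.exists_ball_subset_closure {P : Set ℝ} {n : ℕ → ℕ}
    (hn : IsSpreadingSequence P n) {p₀ m₀ δ : ℝ} (hp₀ : p₀ ∈ P)
    (hm₀ : m₀ ∈ terminatingPoints n) (hδ : 0 < δ) :
    ∃ r > 0, Metric.ball (p₀ + m₀) r ⊆
      closure (P ∩ Metric.ball p₀ δ + terminatingPoints n ∩ Metric.ball m₀ δ) := by
  obtain ⟨hm, K, a, ha⟩ := hm₀
  have hlim : Filter.Tendsto (fun k : ℕ => (1 / 2 : ℝ) ^ k) Filter.atTop (𝓝 0) :=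
    tendsto_pow_atTop_nhds_zero_of_lt_one (by norm_num) (by norm_num)
  -- The strict inequalities in `terminatingPoints` leave room to move `m₀` at the finitely many
  -- indices below `K`; from `K` on, `n j * m₀` is an integer.
  have hev : ∀ᶠ k : ℕ in Filter.atTop, ∀ j ∈ Finset.range K,
      (1 / 2 : ℝ) ^ k < (1 / 2) ^ j - distNearestInt (n j * m₀) :=
    (Filter.eventually_all_finset _).2 fun j _ => hlim.eventually_lt_const (sub_pos.2 (hm j))
  obtain ⟨k, hkj, hkδ, hkK, hkp⟩ := (hev.and ((hlim.eventually_lt_const hδ).and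
    ((Filter.eventually_ge_atTop K).and (Filter.eventually_ge_atTop ⌈|p₀|⌉₊)))).exists
  have hkp : |p₀| ≤ k := (Nat.le_ceil _).trans (by exact_mod_cast hkp)
  have hpow : (0 : ℝ) < (1 / 2) ^ k := by positivity
  have hnk := hn.cast_pos k
  have hnk1 := hn.one_le_cast k
  obtain ⟨ρ, hρ⟩ : ∃ ρ : ℝ, ρ = (1 / 2) ^ k / (8 * n k) := ⟨_, rfl⟩
  have hρ0 : 0 < ρ := by rw [hρ]; positivity
  have hρn : n k * (8 * ρ) = (1 / 2) ^ k := by rw [hρ]; field_simp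
  have hρδ : 8 * ρ < δ := by nlinarith
  refine ⟨ρ, hρ0, fun z hz => Metric.mem_closure_iff.2 fun η hη => ?_⟩
  rw [Metric.mem_ball, Real.dist_eq] at hz
  obtain ⟨J, hJη, hJk⟩ := ((hlim.eventually_lt_const (lt_min hη hρ0)).and
    (Filter.eventually_gt_atTop k)).exists
  rw [lt_min_iff] at hJη
  have hnJ := hn.cast_pos J
  obtain ⟨p, hp, hpp, H⟩ := hn.exists_approx (J - k) k p₀ hp₀ hkp z
  rw [Nat.add_sub_cancel' hJk.le] at H
  have hpρ : |p - p₀| ≤ 2 * ρ := by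
    refine hpp.trans (le_of_eq ?_)
    rw [hρ]
    field_simp
    norm_num
  -- Rounding `z - p` to a multiple of `1 / n J` makes `m` terminate and keeps `p + m` close to `z`.
  obtain ⟨m, hmdef⟩ : ∃ m : ℝ, m = round (n J * (z - p)) / n J := ⟨_, rfl⟩
  have hnJm : n J * m = round (n J * (z - p)) := by rw [hmdef, mul_div_cancel₀ _ hnJ.ne']
  have hmJ : n J * |m - (z - p)| ≤ (1 / 2) ^ J / 2 := by
    have h := H J hJk le_rfl
    rwa [distNearestInt, ← hnJm, ← mul_sub, abs_mul, abs_of_pos hnJ, abs_sub_comm] at h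
  have hmz : |m - (z - p)| ≤ (1 / 2) ^ J / 2 :=
    (le_mul_of_one_le_left (abs_nonneg _) (hn.one_le_cast J)).trans hmJ
  have hpowJ : (0 : ℝ) < (1 / 2) ^ J := by positivity
  have hmm₀ : |m - m₀| ≤ 4 * ρ := by
    have h : m - m₀ = (m - (z - p)) + (z - (p₀ + m₀)) - (p - p₀) := by ring
    rw [h]
    refine (abs_sub _ _).trans ?_
    have := abs_add_le (m - (z - p)) (z - (p₀ + m₀))
    linarith
  have hmt : m ∈ terminatingPoints n := by
    refine ⟨fun j => ?_, J, _, hnJm⟩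
    -- Divisibility handles `j ≥ J`, the choice of `p` handles `k < j < J`, and closeness to `m₀`
    -- handles `j ≤ k`.
    rcases le_or_gt J j with hj | hj
    · rw [hn.distNearestInt_mul_eq_zero hj hnJm]
      positivity
    rcases lt_or_ge k j with hkj' | hjk
    · have h1 := distNearestInt_le_add (n j * m) (n j * (z - p))
      rw [← mul_sub, abs_mul, abs_of_pos (hn.cast_pos j)] at h1
      have h2 := mul_le_mul_of_nonneg_right (hn.cast_le hj.le) (abs_nonneg (m - (z - p)))
      have h3 := H j hkj' hj.le
      have h4 : (1 / 2 : ℝ) ^ J < (1 / 2) ^ j :=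
        pow_lt_pow_right_of_lt_one₀ (by norm_num) (by norm_num) hj
      linarith
    · have h1 := distNearestInt_le_add (n j * m) (n j * m₀)
      rw [← mul_sub, abs_mul, abs_of_pos (hn.cast_pos j)] at h1
      have h2 := mul_le_mul (hn.cast_le hjk) hmm₀ (abs_nonneg _) hnk.le
      rcases lt_or_ge j K with hjK | hjK
      · have h3 := hkj j (Finset.mem_range.2 hjK)
        linarith
      · have h3 := hn.distNearestInt_mul_eq_zero hjK ha
        have h4 : (1 / 2 : ℝ) ^ k ≤ (1 / 2) ^ j :=
          pow_le_pow_of_le_one (by norm_num) (by norm_num) hjk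
        linarith
  refine ⟨p + m, add_mem_add ⟨hp, ?_⟩ ⟨hmt, ?_⟩, ?_⟩
  · rw [Metric.mem_ball, Real.dist_eq]
    linarith
  · rw [Metric.mem_ball, Real.dist_eq]
    linarith
  · rw [dist_comm, Real.dist_eq, show p + m - z = m - (z - p) by ring]
    linarith

/-! ### The covering `F_σ`-set. -/

/-- The points `x` for which the translate of `M ∩ V` by `x` is included in `K`, provided that
`M ∩ V` is nonempty. -/
def translateInto (M V K : Set ℝ) : Set ℝ :=
  {x | (M ∩ V).Nonempty ∧ ∀ m ∈ M ∩ V, x + m ∈ K}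

theorem isClosed_translateInto (M V : Set ℝ) {K : Set ℝ} (hK : IsClosed K) :
    IsClosed (translateInto M V K) := by
  have h : translateInto M V K =
      {_x | (M ∩ V).Nonempty} ∩ ⋂ m ∈ M ∩ V, (fun x => x + m) ⁻¹' K := by
    ext x
    simp [translateInto]
  rw [h]
  exact isClosed_const.inter (isClosed_biInter fun m _ => hK.preimage (by fun_prop))

theorem exists_mem_translateInto {M : Set ℝ} (hM : IsClosed M) (hne : M.Nonempty)
    {B : Set (Set ℝ)} (hB : TopologicalSpace.IsTopologicalBasis B) {K : ℕ → Set ℝ}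
    (hK : ∀ n, IsClosed (K n)) {x : ℝ} (hx : ∀ m ∈ M, x + m ∈ ⋃ n, K n) :
    ∃ n, ∃ V ∈ B, x ∈ translateInto M V (K n) := by
  have : CompleteSpace M := hM.completeSpace_coe
  have : Nonempty M := hne.to_subtype
  obtain ⟨n, m, hm⟩ := nonempty_interior_of_iUnion_of_closed
    (f := fun n => {m : M | x + (m : ℝ) ∈ K n})
    (fun n => (hK n).preimage (by fun_prop))
    (eq_univ_of_forall fun m => by simpa using hx m m.2)
  obtain ⟨U, hUsub, hU, hmU⟩ := mem_interior.1 hm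
  obtain ⟨W, hW, rfl⟩ := isOpen_induced_iff.1 hU
  obtain ⟨V, hV, hmV, hVW⟩ := hB.exists_subset_of_mem_open hmU hW
  exact ⟨n, V, hV, ⟨m, m.2, hmV⟩, fun y hy => hUsub (show (⟨y, hy.1⟩ : M) ∈ _ from hVW hy.2)⟩

theorem isMeagerIn_translateInto_add {P : Set ℝ} {n : ℕ → ℕ} (hn : IsSpreadingSequence P n)
    {V K : Set ℝ} (hV : IsOpen V) (hK : IsClosed K) (hKi : interior K = ∅) (y : ℝ) :
    IsMeagerIn (translateInto (closure (terminatingPoints n)) V K + {y}) P := by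
  have hcl := isClosed_translateInto (closure (terminatingPoints n)) V hK
  have hset : {p : P | (p : ℝ) ∈ translateInto (closure (terminatingPoints n)) V K + {y}} =
      (fun p : P => (p : ℝ) - y) ⁻¹' translateInto (closure (terminatingPoints n)) V K := by
    ext p
    simp [sub_eq_add_neg]
  rw [IsMeagerIn, hset]
  have hcl' := hcl.preimage (f := fun p : P => (p : ℝ) - y) (by fun_prop)
  refine IsNowhereDense.isMeagre ?_
  rw [IsNowhereDense, hcl'.closure_eq, ← not_nonempty_iff_eq_empty]
  rintro ⟨p₀, hp₀⟩
  obtain ⟨U, hUsub, hU, hpU⟩ := mem_interior.1 hp₀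
  obtain ⟨I, hI, rfl⟩ := isOpen_induced_iff.1 hU
  -- This is where `M ∩ V` must be nonempty: otherwise the condition on translates would hold for
  -- every point.
  obtain ⟨m, hmM, hmV⟩ := (hUsub hpU).1
  obtain ⟨m₀, hm₀V, hm₀⟩ := mem_closure_iff.1 hmM V hV hmV
  obtain ⟨δ₁, hδ₁, hδI⟩ := Metric.isOpen_iff.1 hI p₀ hpU
  obtain ⟨δ₂, hδ₂, hδV⟩ := Metric.isOpen_iff.1 hV m₀ hm₀V
  obtain ⟨r, hr, hball⟩ := hn.exists_ball_subset_closure p₀.2 hm₀ (lt_min hδ₁ hδ₂)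
  have hsub : Metric.ball ((p₀ : ℝ) + m₀) r ⊆ (fun x => x - y) ⁻¹' K := by
    refine hball.trans (closure_minimal ?_ (hK.preimage (by fun_prop)))
    rintro _ ⟨p, ⟨hp, hpb⟩, s, ⟨hs, hsb⟩, rfl⟩
    have hpI : p ∈ I := hδI (Metric.ball_subset_ball (min_le_left _ _) hpb)
    have hsV : s ∈ V := hδV (Metric.ball_subset_ball (min_le_right _ _) hsb)
    have h := (hUsub (show (⟨p, hp⟩ : P) ∈ _ from hpI)).2 s ⟨subset_closure hs, hsV⟩
    have h' : p + s - y = p - y + s := by ring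
    rw [mem_preimage, h']
    exact h
  have hopen : IsOpen ((fun x : ℝ => x + y) ⁻¹' Metric.ball ((p₀ : ℝ) + m₀) r) :=
    Metric.isOpen_ball.preimage (by fun_prop)
  have hKsub : (fun x : ℝ => x + y) ⁻¹' Metric.ball ((p₀ : ℝ) + m₀) r ⊆ K := fun x hx => by
    simpa using hsub hx
  have hmem : (p₀ : ℝ) + m₀ - y ∈ interior K :=
    interior_maximal hKsub hopen (by simpa using hr)
  rw [hKi] at hmem
  exact hmem

theorem isFSigma_iUnion {X ι : Type*} [TopologicalSpace X] [Countable ι] [Nonempty ι]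
    {f : ι → Set X} (hf : ∀ i, IsClosed (f i)) : IsFSigma (⋃ i, f i) := by
  obtain ⟨e, he⟩ := exists_surjective_nat ι
  exact ⟨f ∘ e, fun n => hf _, (he.iUnion_comp f).symm⟩

theorem isMeagerIn_iUnion {X ι : Type*} [TopologicalSpace X] [Countable ι] {f : ι → Set X}
    {P : Set X} (hf : ∀ i, IsMeagerIn (f i) P) : IsMeagerIn (⋃ i, f i) P := by
  have h : {p : P | (p : X) ∈ ⋃ i, f i} = ⋃ i, {p : P | (p : X) ∈ f i} := by
    ext p
    simp
  rw [IsMeagerIn, h]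
  exact isMeagre_iUnion hf

theorem mainTheorem6 (C : Set (AddSubgroup ℝ))
    (hC : ∀ G ∈ C, AnalyticSet (G : Set ℝ) ∧ G ≠ ⊤)
    (F : Set (Set ℝ))
    (hF : F = hereditaryFamily ((fun G : AddSubgroup ℝ => (G : Set ℝ)) '' C))
    (hD : ∀ E : Set ℝ, IsDirichletSet E → E ∈ F)
    (A : Set ℝ) (hA : IsPermittedFor F A) :
    IsPerfectlyMeagerTransitive A := by
  intro P hP
  obtain ⟨n, hn⟩ := hP.exists_isSpreadingSequence
  have hAM := hA _ (hD _ (isDirichletSet_closure_terminatingPoints hn.strictMono))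
  rw [hF] at hAM
  obtain ⟨_, ⟨G, hG, rfl⟩, hAG⟩ := hAM
  obtain ⟨K, hK, hGK⟩ := (AddSubgroup.isMeagre_of_analyticSet (hC G hG).1
    (hC G hG).2).exists_subset_iUnion_isClosed
  have hB := TopologicalSpace.isBasis_countableBasis ℝ
  have hne : Nonempty (TopologicalSpace.countableBasis ℝ) := by
    obtain ⟨V, hV, -⟩ := hB.exists_subset_of_mem_open (mem_univ (0 : ℝ)) isOpen_univ
    exact ⟨⟨V, hV⟩⟩
  have hcount : Countable (TopologicalSpace.countableBasis ℝ) :=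
    (TopologicalSpace.countable_countableBasis ℝ).to_subtype
  refine ⟨⋃ i : ℕ × TopologicalSpace.countableBasis ℝ,
    translateInto (closure (terminatingPoints n)) i.2 (K i.1),
    isFSigma_iUnion fun i => isClosed_translateInto _ _ (hK i.1).1, fun x hx => ?_, fun y => ?_⟩
  · obtain ⟨k, V, hV, hxV⟩ := exists_mem_translateInto isClosed_closure
      ⟨0, subset_closure (zero_mem_terminatingPoints n)⟩ hB (fun k => (hK k).1)
      (fun m hm => hGK (hAG (add_mem_add hx hm)))
    exact mem_iUnion.2 ⟨(k, ⟨V, hV⟩), hxV⟩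
  · rw [iUnion_add]
    exact isMeagerIn_iUnion fun i =>
      isMeagerIn_translateInto_add hn (hB.isOpen i.2.2) (hK i.1).1 (hK i.1).2 y
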